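/- Let $G$ be a locally compact Hausdorff group whose identity component $G_0$ is non-compact, let $H$ be a compact subgroup of $G$, and let $\mu$ be a non-zero $G$-invariant Radon measure on the left coset space $G/H$. Let $\pi$ be a continuous unitary representation of $G/H$ on a complex Hilbert space $\mathcal H_\pi$, that is, a map from $G/H$ into the group of unitary operators on $\mathcal H_\pi$ with $\pi(gkH)=\pi(gH)\pi(kH)$ and $\pi(g^{-1}H)=\pi(gH)^*$ for all $g,k\in G$, such that $gH\mapsto\langle\pi(gH)\zeta,\eta\rangle$ is continuous on $G/H$ for all $\zeta,\eta\in\mathcal H_\pi$. Suppose that $\pi$ is irreducible ($\mathcal H_\pi\neq 0$ and its only closed $\pi$-invariant subspaces are $0$ and $\mathcal H_\pi$) and square integrable, meaning that there exists an admissible wavelet, where $\xi\in\mathcal H_\pi$ is called an admissible wavelet if $$0<\int_{G/H}|\langle\xi,\pi(gH)\xi\rangle|^2\,d\mu(gH)<\infty .$$ Let $\xi$ be an admissible wavelet, and for $\eta\in\mathcal H_\pi$ put $W_\xi\eta(gH)=\langle\eta,\pi(gH)\xi\rangle$. Then for every $\eta\in\mathcal H_\pi\setminus\{0\}$ the set $\{gH\in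 G/H : W_\xi\eta(gH)\neq 0\}$ has infinite $\mu$-measure. -/

import Mathlib

open scoped ENNReal InnerProductSpace

/-- A continuous unitary representation of the homogeneous space `G ⧸ H` on a complex Hilbert
space `E`. -/
structure HomogeneousRep (G : Type*) [Group G] [TopologicalSpace G] (H : Subgroup G)
    (E : Type*) [NormedAddCommGroup E] [InnerProductSpace ℂ E] [CompleteSpace E] where
  /-- The operator attached to a coset. -/
  toFun : G ⧸ H → unitary (E →L[ℂ] E)
  map_mul : ∀ g k : G, toFun ((g * k : G) : G ⧸ H) = toFun (g : G ⧸ H) * toFun (k : G ⧸ H)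
  map_inv : ∀ g : G, toFun ((g⁻¹ : G) : G ⧸ H) = star (toFun (g : G ⧸ H))
  continuous_coeff : ∀ ξ η : E, Continuous fun x : G ⧸ H => ⟪(toFun x : E →L[ℂ] E) ξ, η⟫_ℂ

namespace HomogeneousRep

variable {G : Type*} [Group G] [TopologicalSpace G] {H : Subgroup G}
  {E : Type*} [NormedAddCommGroup E] [InnerProductSpace ℂ E] [CompleteSpace E]

/-- Irreducibility: `E` is nonzero and has no closed invariant subspaces other than `0` and
`E`. -/
def IsIrreducible (π : HomogeneousRep G H E) : Prop :=
  Nontrivial E ∧ ∀ V : Submodule ℂ E, IsClosed (V : Set E) →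
    (∀ x : G ⧸ H, ∀ v ∈ V, (π.toFun x : E →L[ℂ] E) v ∈ V) → V = ⊥ ∨ V = ⊤

/-- The wavelet transform `(W_ξ η)(gH) = ⟨η, π(gH) ξ⟩` for the constant rho function `1`.
Mathlib's inner product is linear in its second argument, hence the order of the entries. -/
noncomputable def wavelet (π : HomogeneousRep G H E) (ξ η : E) (x : G ⧸ H) : ℂ :=
  ⟪(π.toFun x : E →L[ℂ] E) ξ, η⟫_ℂ

/-- The constant `C_ξ = ∫ |⟨ξ, π(gH) ξ⟩|² dμ(gH)` as an element of `[0, ∞]`. -/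
noncomputable def admConst [MeasurableSpace (G ⧸ H)] (π : HomogeneousRep G H E)
    (μ : MeasureTheory.Measure (G ⧸ H)) (ξ : E) : ℝ≥0∞ :=
  ∫⁻ x, ‖π.wavelet ξ ξ x‖ₑ ^ 2 ∂μ

/-- `ξ` is an admissible wavelet: `0 < C_ξ < ∞`. -/
def IsAdmissible [MeasurableSpace (G ⧸ H)] (π : HomogeneousRep G H E)
    (μ : MeasureTheory.Measure (G ⧸ H)) (ξ : E) : Prop :=
  0 < π.admConst μ ξ ∧ π.admConst μ ξ < ∞

/-- `π` is square integrable if it has an admissible wavelet. -/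
def IsSquareIntegrable [MeasurableSpace (G ⧸ H)] (π : HomogeneousRep G H E)
    (μ : MeasureTheory.Measure (G ⧸ H)) : Prop :=
  ∃ ξ : E, π.IsAdmissible μ ξ

end HomogeneousRep

open MeasureTheory Filter Topology Set
open scoped Pointwise

/-! ### Schur's lemma. -/

section Schur

variable {E : Type*} [NormedAddCommGroup E] [InnerProductSpace ℂ E] [CompleteSpace E]

/-- Schur's lemma: a self-adjoint operator commuting with a topologically irreducible family of
operators is a real scalar. -/
theorem IsSelfAdjoint.eq_smul_one_of_commute_irreducible [Nontrivial E] {ι : Type*}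
    (u : ι → E →L[ℂ] E)
    (hirr : ∀ V : Submodule ℂ E, IsClosed (V : Set E) → (∀ i, ∀ v ∈ V, u i v ∈ V) →
      V = ⊥ ∨ V = ⊤)
    {T : E →L[ℂ] E} (hT : IsSelfAdjoint T) (hcomm : ∀ i, Commute T (u i)) :
    ∃ c : ℝ, T = c • (1 : E →L[ℂ] E) := by
  obtain ⟨c, hc⟩ := ContinuousFunctionalCalculus.spectrum_nonempty (R := ℝ) T hT
  -- The spectrum is a single point. Otherwise the positive parts of `m - x` and `x - m`, applied to
  -- `T`, are nonzero with product zero, and the kernel of the second is a proper nonzero closed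
  -- invariant subspace.
  have key : ∀ a ∈ spectrum ℝ T, ∀ b ∈ spectrum ℝ T, ¬ a < b := by
    intro a ha b hb hab
    set m := (a + b) / 2 with hm
    have hne : ∀ f : ℝ → ℝ, Continuous f → ∀ x ∈ spectrum ℝ T, f x ≠ 0 → cfc f T ≠ 0 := by
      intro f hf x hx hfx h0
      have h1 : f x ∈ spectrum ℝ (cfc f T) := by
        rw [cfc_map_spectrum f T hT hf.continuousOn]
        exact ⟨x, hx, rfl⟩
      rw [h0, spectrum.zero_eq] at h1
      exact hfx h1
    have hfc : Continuous fun x : ℝ => max (m - x) 0 := by fun_prop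
    have hgc : Continuous fun x : ℝ => max (x - m) 0 := by fun_prop
    have hf0 := hne _ hfc a ha (ne_of_gt (lt_max_of_lt_left (by linarith)))
    have hg0 := hne _ hgc b hb (ne_of_gt (lt_max_of_lt_left (by linarith)))
    have hmul : cfc (fun x : ℝ => max (x - m) 0) T * cfc (fun x : ℝ => max (m - x) 0) T = 0 := by
      rw [← cfc_mul _ _ T hgc.continuousOn hfc.continuousOn]
      convert cfc_zero ℝ T using 2
      ext x
      rcases le_total x m with h | h
      · simp [h]
      · simp [h]
    rcases hirr (LinearMap.ker (cfc (fun x : ℝ => max (x - m) 0) T).toLinearMap)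
      (cfc (fun x : ℝ => max (x - m) 0) T).isClosed_ker (by
        intro i v hv
        have hc := (hT.commute_cfc (hcomm i) fun x : ℝ => max (x - m) 0).eq
        have hc' := congrArg (fun S : E →L[ℂ] E => S v) hc
        simp only [mul_apply_eq_comp] at hc'
        simp only [LinearMap.mem_ker, ContinuousLinearMap.coe_coe] at hv ⊢
        rw [hc', hv, map_zero]) with h | h
    · apply hf0
      ext v
      have : cfc (fun x : ℝ => max (m - x) 0) T v ∈
          LinearMap.ker (cfc (fun x : ℝ => max (x - m) 0) T).toLinearMap :=
        congrArg (fun S : E →L[ℂ] E => S v) hmul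
      rw [h] at this
      simpa using this
    · apply hg0
      ext v
      have : v ∈ LinearMap.ker (cfc (fun x : ℝ => max (x - m) 0) T).toLinearMap := by
        rw [h]; trivial
      simpa using this
  refine ⟨c, ?_⟩
  rw [← Algebra.algebraMap_eq_smul_one]
  refine CFC.eq_algebraMap_of_spectrum_subset_singleton T c ?_ hT
  intro x hx
  exact le_antisymm (not_lt.1 (key c hc x hx)) (not_lt.1 (key x hx c hc))

/-- An injective nonzero bounded operator intertwining adjointable actions, with irreducible
target, is a surjective multiple of an isometry. -/
theorem exists_norm_sq_eq_of_intertwining [Nontrivial E]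
    {F : Type*} [NormedAddCommGroup F] [InnerProductSpace ℂ F] [CompleteSpace F]
    {ι : Type*} (u : ι → E →L[ℂ] E)
    (hirr : ∀ V : Submodule ℂ E, IsClosed (V : Set E) → (∀ i, ∀ v ∈ V, u i v ∈ V) →
      V = ⊥ ∨ V = ⊤)
    (J : F →L[ℂ] E) (hinj : Function.Injective J) (hJ : ∃ γ, J γ ≠ 0)
    (hint : ∀ i, ∃ U V : F → F, (∀ γ, J (U γ) = u i (J γ)) ∧
      (∀ γ, J (V γ) = ContinuousLinearMap.adjoint (u i) (J γ)) ∧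
      ∀ γ δ, ⟪U γ, δ⟫_ℂ = ⟪γ, V δ⟫_ℂ) :
    ∃ c : ℝ, 0 < c ∧ Function.Surjective J ∧ ∀ γ, ‖J γ‖ ^ 2 = c * ‖γ‖ ^ 2 := by
  set J' := ContinuousLinearMap.adjoint J with hJ'
  have hsa : IsSelfAdjoint (J ∘L J') := by
    rw [ContinuousLinearMap.isSelfAdjoint_iff', ContinuousLinearMap.adjoint_comp, hJ',
      ContinuousLinearMap.adjoint_adjoint]
  have hcomm : ∀ i, Commute (J ∘L J') (u i) := by
    intro i
    obtain ⟨U, V, hU, hV, hUV⟩ := hint i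
    ext x
    -- Only the adjointness of the pair `U`, `V` is needed, not their linearity or boundedness.
    have : J' (u i x) = U (J' x) := by
      refine ext_inner_right ℂ fun γ => ?_
      rw [hUV, hJ', ContinuousLinearMap.adjoint_inner_left, ContinuousLinearMap.adjoint_inner_left,
        hV, ContinuousLinearMap.adjoint_inner_right]
    simp [this, hU]
  obtain ⟨c, hc⟩ := hsa.eq_smul_one_of_commute_irreducible u hirr hcomm
  have hc' : ∀ x, J (J' x) = c • x := fun x => by
    simpa using congrArg (fun S : E →L[ℂ] E => S x) hc
  -- Injectivity of `J` turns `J J* = c` into `J* J = c`.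
  have hJJ : ∀ γ, J' (J γ) = c • γ := fun γ => hinj (by
    rw [hc', ← algebraMap_smul ℂ c γ, map_smul, algebraMap_smul])
  have hnorm : ∀ γ, ‖J γ‖ ^ 2 = c * ‖γ‖ ^ 2 := by
    intro γ
    have h1 : ⟪J' (J γ), γ⟫_ℂ = ⟪J γ, J γ⟫_ℂ := ContinuousLinearMap.adjoint_inner_left _ _ _
    rw [hJJ, ← algebraMap_smul ℂ c γ, inner_smul_left, inner_self_eq_norm_sq_to_K,
      inner_self_eq_norm_sq_to_K] at h1
    simp only [Complex.coe_algebraMap, Complex.conj_ofReal] at h1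
    exact_mod_cast h1.symm
  have hcpos : 0 < c := by
    obtain ⟨γ, hγ⟩ := hJ
    have h1 := hnorm γ
    have h2 : 0 < ‖J γ‖ ^ 2 := by positivity
    by_contra! h3
    nlinarith [sq_nonneg ‖γ‖]
  refine ⟨c, hcpos, fun x => ⟨c⁻¹ • J' x, ?_⟩, hnorm⟩
  rw [← algebraMap_smul ℂ (c⁻¹) (J' x), map_smul, algebraMap_smul, hc', smul_smul,
    inv_mul_cancel₀ hcpos.ne', one_smul]

end Schur

/-! ### Translations on `L²`. -/

section Translation

variable {G X : Type*} [Group G] [MulAction G X] [MeasurableSpace X] [MeasurableConstSMul G X]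
  (μ : Measure X) [SMulInvariantMeasure G X μ]

/-- Translation of square integrable functions by a group element. -/
noncomputable def l2Translate (g : G) (f : Lp ℂ 2 μ) : Lp ℂ 2 μ :=
  Lp.compMeasurePreserving (g⁻¹ • ·) (measurePreserving_smul g⁻¹ μ) f

theorem coeFn_l2Translate (g : G) (f : Lp ℂ 2 μ) :
    l2Translate μ g f =ᵐ[μ] fun x => f (g⁻¹ • x) :=
  Lp.coeFn_compMeasurePreserving f (measurePreserving_smul g⁻¹ μ)

theorem inner_l2Translate_left (g : G) (f h : Lp ℂ 2 μ) :
    ⟪l2Translate μ g f, h⟫_ℂ = ⟪f, l2Translate μ g⁻¹ h⟫_ℂ := by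
  rw [L2.inner_def, L2.inner_def,
    ← integral_smul_eq_self (g := g) fun x => ⟪l2Translate μ g f x, h x⟫_ℂ]
  refine integral_congr_ae ?_
  have h1 := (measurePreserving_smul g μ).quasiMeasurePreserving.ae (coeFn_l2Translate μ g f)
  filter_upwards [h1, coeFn_l2Translate μ g⁻¹ h] with x hx hx'
  rw [hx, hx', inv_smul_smul, inv_inv]

end Translation

/-! ### The wavelet transform and its orthogonality relation. -/

namespace HomogeneousRep

variable {G : Type*} [Group G] [TopologicalSpace G] {H : Subgroup G}
  {E : Type*} [NormedAddCommGroup E] [InnerProductSpace ℂ E] [CompleteSpace E]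
  (π : HomogeneousRep G H E)

theorem adjoint_toFun (g : G) :
    ContinuousLinearMap.adjoint (π.toFun (g : G ⧸ H) : E →L[ℂ] E) =
      (π.toFun ((g⁻¹ : G) : G ⧸ H) : E →L[ℂ] E) := by
  rw [π.map_inv]; rfl

theorem wavelet_add (ξ η η' : E) (x : G ⧸ H) :
    π.wavelet ξ (η + η') x = π.wavelet ξ η x + π.wavelet ξ η' x :=
  inner_add_right _ _ _

theorem wavelet_smul (ξ η : E) (a : ℂ) (x : G ⧸ H) :
    π.wavelet ξ (a • η) x = a * π.wavelet ξ η x :=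
  inner_smul_right _ _ _

theorem wavelet_zero (ξ : E) (x : G ⧸ H) : π.wavelet ξ 0 x = 0 :=
  inner_zero_right _

theorem continuous_wavelet (ξ η : E) : Continuous (π.wavelet ξ η) :=
  π.continuous_coeff ξ η

theorem wavelet_toFun (ξ η : E) (g : G) (x : G ⧸ H) :
    π.wavelet ξ ((π.toFun (g : G ⧸ H) : E →L[ℂ] E) η) x = π.wavelet ξ η (g⁻¹ • x) := by
  induction x using QuotientGroup.induction_on with
  | H k =>
    have h : g⁻¹ • (k : G ⧸ H) = ((g⁻¹ * k : G) : G ⧸ H) := rfl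
    rw [wavelet, wavelet, h, π.map_mul, ← ContinuousLinearMap.adjoint_inner_left, adjoint_toFun]
    rfl

variable [MeasurableSpace (G ⧸ H)] (μ : Measure (G ⧸ H))

theorem aestronglyMeasurable_wavelet [BorelSpace (G ⧸ H)] (ξ η : E) :
    AEStronglyMeasurable (π.wavelet ξ η) μ :=
  (π.continuous_wavelet ξ η).measurable.aestronglyMeasurable

/-- The graph of the (possibly unbounded) operator `η ↦ W_ξ η` into `L²(μ)`. -/
def waveletGraph (ξ : E) : Submodule ℂ (WithLp 2 (E × Lp ℂ 2 μ)) where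
  carrier := {p | p.snd =ᵐ[μ] π.wavelet ξ p.fst}
  add_mem' := by
    intro p q hp hq
    simp only [mem_ofPred_eq] at *
    filter_upwards [hp, hq, Lp.coeFn_add p.snd q.snd] with x h1 h2 h3
    rw [WithLp.add_snd, h3, WithLp.add_fst, wavelet_add, Pi.add_apply, h1, h2]
  zero_mem' := by
    simp only [mem_ofPred_eq]
    filter_upwards [Lp.coeFn_zero ℂ 2 μ] with x h
    rw [WithLp.zero_snd, h, WithLp.zero_fst, wavelet_zero, Pi.zero_apply]
  smul_mem' := by
    intro a p hp
    simp only [mem_ofPred_eq] at *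
    filter_upwards [hp, Lp.coeFn_smul a p.snd] with x h1 h2
    rw [WithLp.smul_snd, h2, WithLp.smul_fst, wavelet_smul, Pi.smul_apply, h1, smul_eq_mul]

theorem mem_waveletGraph {ξ : E} {p : WithLp 2 (E × Lp ℂ 2 μ)} :
    p ∈ π.waveletGraph μ ξ ↔ p.snd =ᵐ[μ] π.wavelet ξ p.fst :=
  Iff.rfl

/-- Convergence in `L²` gives almost everywhere convergence along a subsequence, while convergence
of the vectors gives pointwise convergence of their transforms; the two limits agree. -/
theorem isClosed_waveletGraph (ξ : E) :
    IsClosed (π.waveletGraph μ ξ : Set (WithLp 2 (E × Lp ℂ 2 μ))) := by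
  refine IsSeqClosed.isClosed fun p q hp hpq => ?_
  have h1 : Tendsto (fun n => (p n).fst) atTop (𝓝 q.fst) :=
    ((WithLp.prod_continuous_ofLp 2 E (Lp ℂ 2 μ)).fst.tendsto q).comp hpq
  have h2 : Tendsto (fun n => (p n).snd) atTop (𝓝 q.snd) :=
    ((WithLp.prod_continuous_ofLp 2 E (Lp ℂ 2 μ)).snd.tendsto q).comp hpq
  obtain ⟨φ, hφ, hae⟩ := (tendstoInMeasure_of_tendsto_Lp h2).exists_seq_tendsto_ae
  have h3 : ∀ᵐ x ∂μ, ∀ n, (p n).snd x = π.wavelet ξ (p n).fst x := ae_all_iff.2 hp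
  change q.snd =ᵐ[μ] π.wavelet ξ q.fst
  filter_upwards [hae, h3] with x hx hx'
  refine tendsto_nhds_unique hx ?_
  simp only [hx']
  exact ((continuous_const.inner continuous_id).tendsto q.fst).comp (h1.comp hφ.tendsto_atTop)

theorem lintegral_wavelet_eq {ξ : E} {p : WithLp 2 (E × Lp ℂ 2 μ)}
    (hp : p ∈ π.waveletGraph μ ξ) :
    ∫⁻ x, ‖π.wavelet ξ p.fst x‖ₑ ^ 2 ∂μ = ‖p.snd‖ₑ ^ 2 := by
  rw [Lp.enorm_def, eLpNorm_eq_lintegral_rpow_enorm_toReal (by norm_num) (by norm_num),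
    ← ENNReal.rpow_natCast, ← ENNReal.rpow_mul]
  norm_num
  refine lintegral_congr_ae ?_
  filter_upwards [hp] with x hx
  rw [hx]

theorem exists_mem_waveletGraph [BorelSpace (G ⧸ H)] {ξ η : E} (h : ∫⁻ x, ‖π.wavelet ξ η x‖ₑ ^ 2 ∂μ < ∞) :
    ∃ p ∈ π.waveletGraph μ ξ, p.fst = η := by
  have hm : MemLp (π.wavelet ξ η) 2 μ := by
    refine ⟨π.aestronglyMeasurable_wavelet μ ξ η, ?_⟩
    rw [eLpNorm_eq_lintegral_rpow_enorm_toReal (by norm_num) (by norm_num)]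
    refine ENNReal.rpow_lt_top_of_nonneg (by norm_num) (ne_of_lt ?_)
    convert h using 3
    norm_num
  exact ⟨WithLp.toLp 2 (η, hm.toLp), hm.coeFn_toLp, rfl⟩

/-- Orthogonality relation: for an admissible `ξ`, the wavelet transform of an irreducible
representation is a nonzero multiple of an isometry. -/
theorem exists_lintegral_wavelet_eq [BorelSpace (G ⧸ H)] [IsTopologicalGroup G] [SMulInvariantMeasure G (G ⧸ H) μ]
    (hirr : π.IsIrreducible) {ξ : E} (hξ : π.IsAdmissible μ ξ) :
    ∃ c : ℝ≥0∞, c ≠ 0 ∧ ∀ η : E, ∫⁻ x, ‖π.wavelet ξ η x‖ₑ ^ 2 ∂μ = c * ‖η‖ₑ ^ 2 := by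
  have := hirr.1
  have : CompleteSpace (π.waveletGraph μ ξ) :=
    (π.isClosed_waveletGraph μ ξ).completeSpace_coe
  -- `W_ξ` is not yet known to be bounded or everywhere square integrable, so Schur's lemma is
  -- applied to the projection of its graph, which is bounded and injective.
  let J : π.waveletGraph μ ξ →L[ℂ] E :=
    WithLp.fstL 2 ℂ E (Lp ℂ 2 μ) ∘L (π.waveletGraph μ ξ).subtypeL
  have hJ : ∀ γ, J γ = γ.1.fst := fun _ => rfl
  have hξ0 : ξ ≠ 0 := by
    rintro rfl
    have := hξ.1
    simp [admConst, wavelet_zero] at this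
  obtain ⟨p, hp, hpξ⟩ := π.exists_mem_waveletGraph μ hξ.2
  have htrans : ∀ (g : G), ∀ γ ∈ π.waveletGraph μ ξ,
      WithLp.toLp 2 ((π.toFun (g : G ⧸ H) : E →L[ℂ] E) γ.fst, l2Translate μ g γ.snd) ∈
        π.waveletGraph μ ξ := by
    intro g γ hγ
    have h1 := (measurePreserving_smul g⁻¹ μ).quasiMeasurePreserving.ae hγ
    rw [mem_waveletGraph]
    filter_upwards [h1, coeFn_l2Translate μ g γ.snd] with x hx hx'
    exact hx'.trans (hx.trans (π.wavelet_toFun ξ γ.fst g x).symm)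
  obtain ⟨c, hc, hsurj, hnorm⟩ := exists_norm_sq_eq_of_intertwining
    (fun x : G ⧸ H => (π.toFun x : E →L[ℂ] E)) hirr.2 J
    (by
      intro γ δ h
      rw [hJ, hJ] at h
      refine Subtype.ext (WithLp.ofLp_injective 2 (Prod.ext h (Lp.ext ?_)))
      have h1 : γ.1.snd =ᵐ[μ] π.wavelet ξ γ.1.fst := γ.2
      have h2 : δ.1.snd =ᵐ[μ] π.wavelet ξ δ.1.fst := δ.2
      rw [← h] at h2
      exact h1.trans h2.symm)
    ⟨⟨p, hp⟩, by rw [hJ]; exact hpξ ▸ hξ0⟩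
    (by
      intro x
      induction x using QuotientGroup.induction_on with
      | H g =>
        refine ⟨fun γ => ⟨_, htrans g γ.1 γ.2⟩, fun γ => ⟨_, htrans g⁻¹ γ.1 γ.2⟩, fun γ => rfl,
          fun γ => ?_, fun γ δ => ?_⟩
        · rw [adjoint_toFun]; rfl
        · rw [Submodule.coe_inner, Submodule.coe_inner, WithLp.prod_inner_apply,
            WithLp.prod_inner_apply]
          simp only [inner_l2Translate_left, ← adjoint_toFun,
            ContinuousLinearMap.adjoint_inner_right]
          rfl)
  -- In the graph norm, `‖η‖² = c (‖η‖² + ‖W_ξ η‖²)`.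
  have hsnd : ∀ γ : π.waveletGraph μ ξ, ‖γ.1.snd‖ ^ 2 = (c⁻¹ - 1) * ‖γ.1.fst‖ ^ 2 := by
    intro γ
    have h1 := hnorm γ
    have h2 : ‖γ‖ ^ 2 = ‖γ.1.fst‖ ^ 2 + ‖γ.1.snd‖ ^ 2 := WithLp.prod_norm_sq_eq_of_L2 γ.1
    rw [hJ, h2] at h1
    field_simp
    linarith
  have hall : ∀ η : E, ∫⁻ x, ‖π.wavelet ξ η x‖ₑ ^ 2 ∂μ =
      ENNReal.ofReal (c⁻¹ - 1) * ‖η‖ₑ ^ 2 := by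
    intro η
    obtain ⟨γ, rfl⟩ := hsurj η
    rw [hJ, π.lintegral_wavelet_eq μ γ.2, ← ofReal_norm, ← ofReal_norm,
      ← ENNReal.ofReal_pow (norm_nonneg _), ← ENNReal.ofReal_pow (norm_nonneg _), hsnd,
      ENNReal.ofReal_mul' (by positivity)]
  refine ⟨_, fun h0 => ?_, hall⟩
  have h1 := hξ.1
  rw [admConst, hall, h0, zero_mul] at h1
  exact lt_irrefl _ h1

/-- Linearly independent vectors whose wavelet transforms are supported in a common set `B` are
at most `‖ξ‖² μ(B) / c` in number. -/
theorem card_mul_le_of_support_subset [BorelSpace (G ⧸ H)] {ξ : E} {c : ℝ≥0∞}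
    (hc : ∀ η : E, ∫⁻ x, ‖π.wavelet ξ η x‖ₑ ^ 2 ∂μ = c * ‖η‖ₑ ^ 2)
    {B : Set (G ⧸ H)} (hB : MeasurableSet B) {n : ℕ} {v : Fin n → E}
    (hv : LinearIndependent ℂ v) (hvB : ∀ i, ∀ x ∉ B, π.wavelet ξ (v i) x = 0) :
    n * c ≤ ‖ξ‖ₑ ^ 2 * μ B := by
  let N : Submodule ℂ E :=
    { carrier := {η | ∀ x ∉ B, π.wavelet ξ η x = 0}
      add_mem' := fun ha hb x hx => by rw [wavelet_add, ha x hx, hb x hx, add_zero]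
      zero_mem' := fun x _ => π.wavelet_zero ξ x
      smul_mem' := fun a η hη x hx => by rw [wavelet_smul, hη x hx, mul_zero] }
  have hspan : Submodule.span ℂ (range v) ≤ N :=
    Submodule.span_le.2 (range_subset_iff.2 hvB)
  -- Orthonormalizing stays inside the span, so the transforms still vanish off `B`.
  let e := InnerProductSpace.gramSchmidtNormed ℂ v
  have he : Orthonormal ℂ e := InnerProductSpace.gramSchmidtNormed_orthonormal hv
  have heN : ∀ i, e i ∈ N := fun i => hspan (by
    rw [← InnerProductSpace.span_gramSchmidt, ← InnerProductSpace.span_gramSchmidtNormed_range]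
    exact Submodule.subset_span ⟨i, rfl⟩)
  calc (n : ℝ≥0∞) * c = ∑ i, ∫⁻ x, ‖π.wavelet ξ (e i) x‖ₑ ^ 2 ∂μ := by
        have h1 : ∀ i, ‖e i‖ₑ = 1 := fun i => by
          rw [← ofReal_norm, he.1 i, ENNReal.ofReal_one]
        simp [hc, h1]
    _ = ∫⁻ x, ∑ i, ‖π.wavelet ξ (e i) x‖ₑ ^ 2 ∂μ := by
        rw [lintegral_finsetSum]
        intro i _
        exact ((π.continuous_wavelet ξ (e i)).measurable.enorm.pow_const 2)
    _ ≤ ∫⁻ x, B.indicator (fun _ => ‖ξ‖ₑ ^ 2) x ∂μ := by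
        refine lintegral_mono fun x => ?_
        by_cases hx : x ∈ B
        · rw [indicator_of_mem hx]
          -- Bessel's inequality for `π(x) ξ`, whose norm is `‖ξ‖`.
          have h1 := he.sum_inner_products_le ((π.toFun x : E →L[ℂ] E) ξ) (s := Finset.univ)
          have h2 : ‖(π.toFun x : E →L[ℂ] E) ξ‖ = ‖ξ‖ :=
            ContinuousLinearMap.norm_map_of_mem_unitary (π.toFun x).2 ξ
          rw [h2] at h1
          calc ∑ i, ‖π.wavelet ξ (e i) x‖ₑ ^ 2
              = ENNReal.ofReal (∑ i, ‖⟪e i, (π.toFun x : E →L[ℂ] E) ξ⟫_ℂ‖ ^ 2) := by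
                rw [ENNReal.ofReal_sum_of_nonneg fun i _ => by positivity]
                refine Finset.sum_congr rfl fun i _ => ?_
                rw [ENNReal.ofReal_pow (norm_nonneg _), norm_inner_symm, ofReal_norm]
                rfl
            _ ≤ ENNReal.ofReal (‖ξ‖ ^ 2) := ENNReal.ofReal_le_ofReal h1
            _ = ‖ξ‖ₑ ^ 2 := by
                rw [ENNReal.ofReal_pow (norm_nonneg _), ofReal_norm]
        · simp [fun i => heN i x hx]
    _ = ‖ξ‖ₑ ^ 2 * μ B := by
        rw [lintegral_indicator hB, setLIntegral_const]

end HomogeneousRep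

/-! ### Translates of open sets in the homogeneous space. -/

section Translates

variable {G : Type*} [Group G] [TopologicalSpace G] [IsTopologicalGroup G]
  {H : Subgroup G}

/-- In a homogeneous space by a compact subgroup, a nonempty open set contains an open set with
infinitely many disjoint translates by elements of a given noncompact closed set. -/
theorem exists_isOpen_pairwise_disjoint_smul [LocallyCompactSpace G] (hH : IsCompact (H : Set G))
    {S : Set G} (hS : IsClosed S) (hSc : ¬ IsCompact S) {A : Set (G ⧸ H)} (hA : IsOpen A)
    (hne : A.Nonempty) :
    ∃ O ⊆ A, IsOpen O ∧ O.Nonempty ∧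
      ∃ f : ℕ → G, (∀ n, f n ∈ S) ∧ Pairwise fun m n => Disjoint (f m • O) (f n • O) := by
  obtain ⟨x, hx⟩ := hne
  obtain ⟨g₀, rfl⟩ := QuotientGroup.mk_surjective x
  obtain ⟨K, hKc, hgK, hKA⟩ := exists_compact_subset
    (hA.preimage (QuotientGroup.continuous_mk (N := H))) hx
  refine ⟨QuotientGroup.mk '' interior K, ?_, QuotientGroup.isOpenMap_coe _ isOpen_interior,
    ⟨_, g₀, hgK, rfl⟩, ?_⟩
  · rintro _ ⟨k, hk, rfl⟩
    exact hKA (interior_subset hk)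
  have : Std.Symm fun a b : G => Disjoint (a • (QuotientGroup.mk '' interior K : Set (G ⧸ H)))
      (b • (QuotientGroup.mk '' interior K : Set (G ⧸ H))) := ⟨fun _ _ h => h.symm⟩
  obtain ⟨f, hf, hd⟩ := exists_seq_of_forall_finset_exists' (· ∈ S)
    (fun a b : G => Disjoint (a • (QuotientGroup.mk '' interior K : Set (G ⧸ H)))
      (b • (QuotientGroup.mk '' interior K : Set (G ⧸ H)))) (by
      intro s _
      -- If the translates by `a` and `b` meet, then `b ∈ a K H K⁻¹`. This is compact because `H`
      -- is, so finitely many such sets cannot cover `S`.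
      have hC : IsCompact (⋃ a ∈ s, a • (K * (H : Set G) * K⁻¹)) :=
        s.isCompact_biUnion fun a _ => ((hKc.mul hH).mul hKc.inv).smul a
      have hnot : ¬ S ⊆ ⋃ a ∈ s, a • (K * (H : Set G) * K⁻¹) :=
        fun h => hSc (hC.of_isClosed_subset hS h)
      obtain ⟨b, hb, hbC⟩ := not_subset.1 hnot
      refine ⟨b, hb, fun a ha => Set.disjoint_left.2 ?_⟩
      rintro _ ⟨_, ⟨k, hk, rfl⟩, rfl⟩ ⟨_, ⟨l, hl, rfl⟩, hkl⟩
      apply hbC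
      have h1 : ((a * k : G) : G ⧸ H) = ((b * l : G) : G ⧸ H) := hkl.symm
      rw [QuotientGroup.eq] at h1
      refine mem_iUnion₂.2 ⟨a, ha, mem_smul_set.2 ⟨k * ((a * k)⁻¹ * (b * l)) * l⁻¹, ?_, ?_⟩⟩
      · exact mul_mem_mul (mul_mem_mul (interior_subset hk) h1)
          (Set.inv_mem_inv.2 (interior_subset hl))
      · rw [smul_eq_mul]; group)
  exact ⟨f, hf, hd⟩

variable [MeasurableSpace (G ⧸ H)] [BorelSpace (G ⧸ H)] (μ : Measure (G ⧸ H))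
  [SMulInvariantMeasure G (G ⧸ H) μ]

/-- An open set of finite measure in a homogeneous space is moved little by group elements close
to the identity. -/
theorem eventually_measure_smul_sdiff_lt [T2Space (G ⧸ H)] [μ.Regular] {A : Set (G ⧸ H)}
    (hA : IsOpen A) (hAfin : μ A ≠ ∞) {ε : ℝ≥0∞} (hε : ε ≠ 0) :
    ∀ᶠ g : G in 𝓝 1, μ (g • A \ A) < ε := by
  obtain ⟨K, hKA, hK, hμK⟩ := hA.measurableSet.exists_isCompact_sdiff_lt (μ := μ) hAfin hε
  -- By compactness `g • K ⊆ A` for `g` near `1`; then `g • A \ A` lies in `g • (A \ K)`, of measure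
  -- below `ε`.
  have h1 : ∀ᶠ g : G in 𝓝 1, ∀ x ∈ K, g • x ∈ A := by
    refine hK.eventually_forall_of_forall_eventually fun x hx => ?_
    refine (continuous_smul.tendsto ((1 : G), x)).eventually (hA.mem_nhds ?_)
    rw [one_smul]
    exact hKA hx
  filter_upwards [h1] with g hg
  refine lt_of_le_of_lt ?_ hμK
  rw [← measure_smul μ g (A \ K), smul_set_sdiff]
  refine measure_mono (sdiff_subset_sdiff_right ?_)
  rintro _ ⟨x, hx, rfl⟩
  exact hg x hx

/-- If the identity component is noncompact, an open set can be translated so that it leaves a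
given set of finite measure containing it, by a non-null but arbitrarily small amount. -/
theorem exists_measure_smul_sdiff_ne_zero_of_le [LocallyCompactSpace G] [T2Space (G ⧸ H)]
    [μ.Regular] (hμ : μ ≠ 0) (hH : IsCompact (H : Set G))
    (hG₀ : ¬ IsCompact (connectedComponent (1 : G)))
    {A B : Set (G ⧸ H)} (hA : IsOpen A) (hne : A.Nonempty) (hAB : A ⊆ B)
    (hBfin : μ B ≠ ∞) {ε : ℝ≥0∞} (hε : ε ≠ 0) :
    ∃ g : G, μ (g • A \ B) ≠ 0 ∧ μ (g • A \ B) ≤ ε := by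
  by_contra! hcon
  have hsmall := eventually_measure_smul_sdiff_lt (G := G) μ hA
    (ne_top_of_le_ne_top hBfin (measure_mono hAB)) hε
  -- By `hcon` an excess of at most `ε` is zero, so vanishing of the excess passes between nearby
  -- group elements, in both directions.
  have hstep : ∀ g g' : G, μ ((g'⁻¹ * g) • A \ A) < ε → μ (g' • A \ B) = 0 →
      μ (g • A \ B) = 0 := by
    intro g g' hlt h0
    by_contra hg
    refine lt_irrefl _ ((hcon g hg).trans_le ?_)
    calc μ (g • A \ B) ≤ μ (g • A \ g' • A ∪ g' • A \ B) := by
          refine measure_mono fun x hx => ?_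
          by_cases h : x ∈ g' • A
          · exact Or.inr ⟨h, hx.2⟩
          · exact Or.inl ⟨hx.1, h⟩
      _ ≤ μ (g • A \ g' • A) + μ (g' • A \ B) := measure_union_le _ _
      _ = μ ((g'⁻¹ * g) • A \ A) := by
          rw [h0, add_zero, ← measure_smul μ g' ((g'⁻¹ * g) • A \ A), smul_set_sdiff, smul_smul,
            mul_inv_cancel_left]
      _ ≤ ε := hlt.le
  have hclopen : IsClopen {g : G | μ (g • A \ B) = 0} := by
    constructor
    · rw [← isOpen_compl_iff, isOpen_iff_mem_nhds]
      intro g hg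
      have h1 : Tendsto (fun g' : G => g'⁻¹ * g) (𝓝 g) (𝓝 1) := by
        have : Continuous fun g' : G => g'⁻¹ * g := by fun_prop
        simpa using this.tendsto g
      filter_upwards [h1.eventually hsmall] with g' hg' h0
      exact hg (hstep g g' hg' h0)
    · rw [isOpen_iff_mem_nhds]
      intro g hg
      have h1 : Tendsto (fun g' : G => g⁻¹ * g') (𝓝 g) (𝓝 1) := by
        have : Continuous fun g' : G => g⁻¹ * g' := by fun_prop
        simpa using this.tendsto g
      filter_upwards [h1.eventually hsmall] with g' hg'
      exact hstep g' g hg' hg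
  have hG : connectedComponent (1 : G) ⊆ {g : G | μ (g • A \ B) = 0} := by
    refine hclopen.connectedComponent_subset ?_
    change μ ((1 : G) • A \ B) = 0
    rw [one_smul, sdiff_eq_empty.2 hAB, measure_empty]
  obtain ⟨O, hOA, hO, hOne, f, hf, hd⟩ :=
    exists_isOpen_pairwise_disjoint_smul hH isClosed_connectedComponent hG₀ hA hne
  have hpos : 0 < μ O := measure_isOpen_pos_of_smulInvariant_of_ne_zero G hμ hO hOne
  -- Each `f n` lies in the identity component, so `f n • O` is contained in `B` up to a null set.
  have hle : μ (⋃ n, f n • O) ≤ μ B := by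
    refine measure_mono_ae ?_
    rw [ae_le_set, iUnion_sdiff]
    refine measure_iUnion_null fun n => ?_
    exact measure_mono_null (sdiff_subset_sdiff_left (smul_set_mono hOA)) (hG (hf n))
  rw [measure_iUnion hd fun n => (hO.smul (f n)).measurableSet] at hle
  simp only [measure_smul, ENNReal.tsum_const_eq_top_of_ne_zero hpos.ne'] at hle
  exact hBfin (top_le_iff.1 hle)

end Translates

/-! ### Many independent vectors on a set of finite measure, and the conclusion. -/

namespace HomogeneousRep

variable {G : Type*} [Group G] [TopologicalSpace G] [IsTopologicalGroup G]
  [LocallyCompactSpace G] {H : Subgroup G} [T2Space (G ⧸ H)]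
  [MeasurableSpace (G ⧸ H)] [BorelSpace (G ⧸ H)]
  {E : Type*} [NormedAddCommGroup E] [InnerProductSpace ℂ E] [CompleteSpace E]

/-- If the support of `W_ξ η` has finite measure, then there are arbitrarily many linearly
independent vectors whose wavelet transforms live on a set of barely larger measure. -/
theorem exists_linearIndependent_support_subset (π : HomogeneousRep G H E)
    (μ : Measure (G ⧸ H)) [μ.Regular] [SMulInvariantMeasure G (G ⧸ H) μ] (hμ : μ ≠ 0)
    (hH : IsCompact (H : Set G)) (hG₀ : ¬ IsCompact (connectedComponent (1 : G)))
    {ξ η : E} (hne : {x | π.wavelet ξ η x ≠ 0}.Nonempty)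
    (hfin : μ {x | π.wavelet ξ η x ≠ 0} ≠ ∞) {ε : ℝ≥0∞} (hε : ε ≠ 0) (hε' : ε ≠ ∞) (n : ℕ) :
    ∃ B : Set (G ⧸ H), MeasurableSet B ∧ {x | π.wavelet ξ η x ≠ 0} ⊆ B ∧
      μ B ≤ μ {x | π.wavelet ξ η x ≠ 0} + n * ε ∧
      ∃ v : Fin n → E, LinearIndependent ℂ v ∧ ∀ i, ∀ x ∉ B, π.wavelet ξ (v i) x = 0 := by
  set A := {x | π.wavelet ξ η x ≠ 0} with hAdef
  have hA : IsOpen A := isOpen_ne_fun (π.continuous_wavelet ξ η) continuous_const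
  induction n with
  | zero =>
    exact ⟨A, hA.measurableSet, subset_rfl, by simp, Fin.elim0,
      linearIndependent_empty_type, fun i => i.elim0⟩
  | succ n ih =>
    obtain ⟨B, hB, hAB, hμB, v, hv, hvB⟩ := ih
    have hBfin : μ B ≠ ∞ := ne_top_of_le_ne_top
      (ENNReal.add_ne_top.2 ⟨hfin, ENNReal.mul_ne_top (ENNReal.natCast_ne_top n) hε'⟩) hμB
    obtain ⟨g, hg0, hgε⟩ :=
      exists_measure_smul_sdiff_ne_zero_of_le μ hμ hH hG₀ hA hne hAB hBfin hε
    have hsupp : ∀ x, π.wavelet ξ ((π.toFun (g : G ⧸ H) : E →L[ℂ] E) η) x ≠ 0 ↔ x ∈ g • A := by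
      intro x
      rw [wavelet_toFun, mem_smul_set_iff_inv_smul_mem]
      rfl
    refine ⟨B ∪ g • A, hB.union (hA.smul g).measurableSet, hAB.trans subset_union_left, ?_,
      Fin.cons ((π.toFun (g : G ⧸ H) : E →L[ℂ] E) η) v, ?_, ?_⟩
    · calc μ (B ∪ g • A) = μ (B ∪ g • A \ B) := by rw [union_sdiff_self]
        _ ≤ μ B + μ (g • A \ B) := measure_union_le _ _
        _ ≤ μ A + n * ε + ε := add_le_add hμB hgε
        _ = μ A + (n + 1 : ℕ) * ε := by push_cast; ring
    -- A vector in the old span has transform zero off `B`, which would force `g • A ⊆ B` against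
    -- the nonzero excess.
    · refine linearIndependent_finCons.2 ⟨hv, fun hmem => hg0 ?_⟩
      have hzero : ∀ x ∉ B, π.wavelet ξ ((π.toFun (g : G ⧸ H) : E →L[ℂ] E) η) x = 0 := by
        intro x hx
        refine Submodule.span_induction (p := fun w _ => π.wavelet ξ w x = 0) ?_
          (π.wavelet_zero ξ x) (fun a b _ _ ha hb => by rw [wavelet_add, ha, hb, add_zero])
          (fun a w _ hw => by rw [wavelet_smul, hw, mul_zero]) hmem
        rintro _ ⟨i, rfl⟩
        exact hvB i x hx
      have hsub : g • A ⊆ B := fun x hx => by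
        by_contra hxB
        exact (hsupp x).2 hx (hzero x hxB)
      rw [sdiff_eq_empty.2 hsub, measure_empty]
    · intro i x hx
      rw [mem_union, not_or] at hx
      refine Fin.cases ?_ (fun j => ?_) i
      · rw [Fin.cons_zero]
        by_contra h
        exact hx.2 ((hsupp x).1 h)
      · rw [Fin.cons_succ]
        exact hvB j x hx.1

end HomogeneousRep

theorem mainTheorem1 {G : Type*} [Group G] [TopologicalSpace G] [IsTopologicalGroup G]
    [LocallyCompactSpace G] [T2Space G]
    (H : Subgroup G) (hH : IsCompact (H : Set G))
    (hG₀ : ¬ IsCompact (connectedComponent (1 : G)))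
    [MeasurableSpace (G ⧸ H)] [BorelSpace (G ⧸ H)]
    (μ : MeasureTheory.Measure (G ⧸ H)) [μ.Regular]
    [MeasureTheory.SMulInvariantMeasure G (G ⧸ H) μ] (hμ : μ ≠ 0)
    {E : Type*} [NormedAddCommGroup E] [InnerProductSpace ℂ E] [CompleteSpace E]
    (π : HomogeneousRep G H E) (hirr : π.IsIrreducible) (hsq : π.IsSquareIntegrable μ)
    (ξ : E) (hξ : π.IsAdmissible μ ξ) (η : E) (hη : η ≠ 0) :
    μ {x : G ⧸ H | π.wavelet ξ η x ≠ 0} = ∞ := by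
  -- Closedness of `H` supplies the Hausdorff property of `G ⧸ H` by instance inference.
  have : IsClosed (H : Set G) := hH.isClosed
  obtain ⟨c, hc0, hc⟩ := π.exists_lintegral_wavelet_eq μ hirr hξ
  by_contra hfin
  set A := {x : G ⧸ H | π.wavelet ξ η x ≠ 0} with hA
  have hne : A.Nonempty := by
    by_contra hempty
    have h0 : ∀ x, π.wavelet ξ η x = 0 := fun x => by
      by_contra hx
      exact hempty ⟨x, hx⟩
    have h1 := hc η
    simp [h0, hc0, hη] at h1
  have hM : ‖ξ‖ₑ ^ 2 * (μ A + 1) ≠ ∞ :=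
    ENNReal.mul_ne_top (by simp) (ENNReal.add_ne_top.2 ⟨hfin, ENNReal.one_ne_top⟩)
  -- The `1` in `μ A + 1` is the total growth `n * ε` for the choice `ε = 1 / n` below, so `n` can
  -- be fixed before `B`.
  obtain ⟨n, hn⟩ := ENNReal.exists_nat_mul_gt hc0 hM
  have hn0 : n ≠ 0 := by
    rintro rfl
    simp at hn
  obtain ⟨B, hB, -, hμB, v, hv, hvB⟩ := π.exists_linearIndependent_support_subset μ hμ hH hG₀
    hne hfin (ε := (n : ℝ≥0∞)⁻¹) (by simp) (by simpa using hn0) n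
  rw [ENNReal.mul_inv_cancel (by simpa using hn0) (by simp)] at hμB
  refine lt_irrefl _ (hn.trans_le ?_)
  exact (π.card_mul_le_of_support_subset μ hc hB hv hvB).trans (by gcongr)
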